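/- Let $B$ be a field and let $A$ be a separable field extension of $B$ of finite degree $n$. For $a\in A$ let $x^n-s_1(a)x^{n-1}+\cdots+(-1)^n s_n(a)$ be the characteristic polynomial of the $B$-linear map $A\to A$ given by multiplication by $a$, and for $1\le i\le n$ let $a^{(i)}=1\otimes\cdots\otimes a\otimes\cdots\otimes 1\in A^{\otimes n}$ (tensor power over $B$, $a$ in the $i$-th factor). Let $I(A,B)\subset A^{\otimes n}$ be the ideal generated by all elements $s_j(a)-\sum_{1\le i_1<\cdots<i_j\le n}a^{(i_1)}\cdots a^{(i_j)}$ with $a\in A$ and $1\le j\le n$, and put $G(A/B)=A^{\otimes n}/I(A,B)$. Let $\widetilde A$ be a Galois closure of $A$ over $B$. Then $[\widetilde A:B]$ divides $n!$ and, with $r=n!/[\widetilde A:B]$, there is an isomorphism of $B$-algebras $$G(A/B)\cong\widetilde A^{\,r}.$$ In particular, if $[\widetilde A:B]=n!$ (equivalently, if $\mathrm{Gal}(\widetilde A/B)\cong S_n$), then $G(A/B)\cong\widetilde A$ as $B$-algebras. -/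

import Mathlib

open scoped TensorProduct

noncomputable section

namespace RankClosure

variable (B A : Type*) [CommRing B] [CommRing A] [Algebra B A]

/-- The coefficient `s_j(a)` of the characteristic polynomial
`x ^ n - s_1(a) x ^ (n - 1) + ⋯ + (-1) ^ n s_n(a)` of multiplication by `a` on `A`, where `A` is
free of rank `n` over `B` and `j ≤ n`. -/
def charCoeff [Module.Free B A] [Module.Finite B A] (j : ℕ) (a : A) : B :=
  (-1) ^ j * (LinearMap.mulLeft B a).charpoly.coeff (Module.finrank B A - j)

/-- The `n`-th tensor power `A ⊗ ⋯ ⊗ A` over `B`, where `n` is the rank of `A`, as a `B`-algebra. -/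
abbrev TensorPow : Type _ := ⨂[B] (_ : Fin (Module.finrank B A)), A

/-- The element `a^(i) = 1 ⊗ ⋯ ⊗ a ⊗ ⋯ ⊗ 1`, with `a` in the `i`-th factor. -/
def conj (i : Fin (Module.finrank B A)) (a : A) : TensorPow B A :=
  PiTensorProduct.tprod B (Function.update (fun _ => (1 : A)) i a)

/-- The ideal `I(A, B)` generated by all
`s_j(a) - ∑_{i_1 < ⋯ < i_j} a^(i_1) ⋯ a^(i_j)` with `a ∈ A` and `1 ≤ j ≤ n`. -/
def relIdeal [Module.Free B A] [Module.Finite B A] : Ideal (TensorPow B A) :=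
  Ideal.span {x | ∃ (a : A) (j : ℕ), 1 ≤ j ∧ j ≤ Module.finrank B A ∧
    x = algebraMap B (TensorPow B A) (charCoeff B A j a) -
      ∑ s ∈ (Finset.univ : Finset (Fin (Module.finrank B A))).powersetCard j,
        ∏ i ∈ s, conj B A i a}

/-- The `S_n`-closure `G(A/B) = A^{⊗ n} / I(A, B)` of an algebra `A` that is free of rank `n`
over `B`. -/
abbrev SnClosure [Module.Free B A] [Module.Finite B A] : Type _ :=
  TensorPow B A ⧸ relIdeal B A

end RankClosure

end

/-! Write $G=G(A/B)$. By Vieta, the relations in $I(A,B)$ say exactly that the characteristic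
polynomial of each $a$ becomes $\prod_i(X-a^{(i)})$. A homomorphism $G\to\widetilde A$ is thus an
$n$-tuple of embeddings $A\to\widetilde A$ splitting all these polynomials. Applied to a primitive
element, this forces every embedding to occur, so the tuple orders the $n$ embeddings; conversely
every ordering works. Hence there are $n!$ homomorphisms (`card_snClosure_algHom`).

Since $A$ is separable, $G$ is unramified, so it is a finite reduced algebra: the product of its
residue fields. Each of these is isomorphic to $\widetilde A$ (`nonempty_algEquiv_of_surjective`)
and so accounts for $[\widetilde A:B]$ homomorphisms. Counting gives $n!=r\,[\widetilde A:B]$ with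
$r$ factors. -/

open scoped TensorProduct

namespace RankClosure

/-! ### Tensor powers of an algebra -/

section TensorPower

variable {R S : Type*} [CommRing R] [CommRing S] [Algebra R S] {ι : Type*}

/-- Two homomorphisms that agree modulo a square-zero ideal already agree on each tensor factor, and
the factors generate. -/
theorem formallyUnramified_piTensorProduct [Finite ι] [Algebra.FormallyUnramified R S] :
    Algebra.FormallyUnramified R (⨂[R] _ : ι, S) := by
  classical
  rw [Algebra.FormallyUnramified.iff_comp_injective]
  intro C _ _ I hI f g hfg
  refine PiTensorProduct.algHom_ext fun i ↦ ?_
  apply Algebra.FormallyUnramified.comp_injective I hI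
  change ((Ideal.Quotient.mkₐ R I).comp f).comp _ = ((Ideal.Quotient.mkₐ R I).comp g).comp _
  exact congrArg (AlgHom.comp · (PiTensorProduct.singleAlgHom i)) hfg

theorem tprod_eq_prod_singleAlgHom [Fintype ι] [DecidableEq ι] (x : ι → S) :
    PiTensorProduct.tprod R x =
      ∏ i, PiTensorProduct.singleAlgHom (R := R) (A := fun _ : ι ↦ S) i (x i) := by
  simp only [PiTensorProduct.singleAlgHom_apply, MonoidHom.mulSingle_apply]
  rw [← PiTensorProduct.tprod_prod, Finset.univ_prod_mulSingle]

theorem mem_of_forall_singleAlgHom_mem [Fintype ι] [DecidableEq ι]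
    (T : Subalgebra R (⨂[R] _ : ι, S))
    (h : ∀ i (a : S), PiTensorProduct.singleAlgHom (R := R) (A := fun _ : ι ↦ S) i a ∈ T)
    (z : ⨂[R] _ : ι, S) : z ∈ T := by
  induction z using PiTensorProduct.induction_on with
  | smul_tprod r x =>
    rw [tprod_eq_prod_singleAlgHom]
    exact T.smul_mem (T.prod_mem fun i _ ↦ h i (x i)) r
  | add x y hx hy => exact T.add_mem hx hy

/-- The algebra homomorphism out of a tensor power induced by a family of homomorphisms. -/
noncomputable def liftFamily [Fintype ι] {T : Type*} [CommRing T] [Algebra R T]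
    (σ : ι → S →ₐ[R] T) : (⨂[R] _ : ι, S) →ₐ[R] T :=
  PiTensorProduct.liftAlgHom
    ((MultilinearMap.mkPiAlgebra R ι T).compLinearMap fun i ↦ (σ i).toLinearMap)
    (by simp) (by simp [Finset.prod_mul_distrib])

theorem liftFamily_singleAlgHom [Fintype ι] [DecidableEq ι] {T : Type*} [CommRing T] [Algebra R T]
    (σ : ι → S →ₐ[R] T) (i : ι) (a : S) :
    liftFamily σ (PiTensorProduct.singleAlgHom i a) = σ i a := by
  have h : liftFamily σ (PiTensorProduct.singleAlgHom i a) = 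
      ∏ j, σ j ((Pi.mulSingle i a : ι → S) j) :=
    PiTensorProduct.lift.tprod (φ := (MultilinearMap.mkPiAlgebra R ι T).compLinearMap
      fun i ↦ (σ i).toLinearMap) _
  rw [h, Finset.prod_eq_single i]
  · simp
  · intro j _ hj
    simp [Pi.mulSingle_eq_of_ne hj]
  · simp

end TensorPower

/-! ### Roots and elementary symmetric functions -/

section Vieta

open Polynomial

theorem eq_prod_X_sub_C_iff {R : Type*} [CommRing R] {ι : Type*} [Fintype ι] {p : R[X]}
    (hp : p.Monic) (hd : p.natDegree = Fintype.card ι) (x : ι → R) :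
    p = ∏ i, (X - C (x i)) ↔ ∀ j, 1 ≤ j → j ≤ Fintype.card ι →
      (-1) ^ j * p.coeff (Fintype.card ι - j) =
        ∑ s ∈ (Finset.univ : Finset ι).powersetCard j, ∏ i ∈ s, x i := by
  have key : ∀ j ≤ Fintype.card ι, (∏ i, (X - C (x i))).coeff (Fintype.card ι - j) =
      (-1) ^ j * ∑ s ∈ (Finset.univ : Finset ι).powersetCard j, ∏ i ∈ s, x i := by
    intro j hj
    have h := Multiset.prod_X_sub_C_coeff ((Finset.univ : Finset ι).val.map x)
      (k := Fintype.card ι - j) (by simp)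
    rw [Multiset.map_map] at h
    have hc : Multiset.card ((Finset.univ : Finset ι).val.map x) - (Fintype.card ι - j) = j := by
      rw [Multiset.card_map, Finset.card_val, Finset.card_univ]; omega
    rw [hc, Finset.esymm_map_val] at h
    exact h
  have sq : ∀ j (y : R), (-1) ^ j * ((-1) ^ j * y) = y := fun j y ↦ by
    rw [← mul_assoc, ← mul_pow]; simp
  constructor
  · rintro h j - hj
    rw [h, key j hj, sq]
  · intro h
    have hq : (∏ i, (X - C (x i))).Monic := monic_prod_of_monic _ _ fun i _ ↦ monic_X_sub_C _
    ext k
    rcases lt_trichotomy k (Fintype.card ι) with hk | hk | hk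
    · have hk' : Fintype.card ι - (Fintype.card ι - k) = k := by omega
      have h1 := h (Fintype.card ι - k) (by omega) (by omega)
      have h2 := key (Fintype.card ι - k) (by omega)
      rw [← h1, sq, hk'] at h2
      exact h2.symm
    -- The hypothesis omits `j = 0`; the leading coefficients agree because both sides are monic.
    · have h2 := key 0 (Nat.zero_le _)
      simp only [Nat.sub_zero, pow_zero, Finset.powersetCard_zero, Finset.sum_singleton,
        Finset.prod_empty, mul_one] at h2
      rw [hk, h2, ← hd, hp.coeff_natDegree]
    · nontriviality R
      rw [coeff_eq_zero_of_natDegree_lt (hd ▸ hk), coeff_eq_zero_of_natDegree_lt]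
      rwa [natDegree_finsetProd_X_sub_C_eq_card]

end Vieta

/-! ### Characteristic polynomials and embeddings -/

section Charpoly

open Polynomial

/-- The characteristic polynomial of multiplication by `a` splits into the conjugates of `a`. -/
theorem charpoly_mulLeft_map_eq_prod {F E K : Type*} [Field F] [Field E] [Field K] [Algebra F E]
    [Algebra F K] [FiniteDimensional F E] {ι : Type*} [Fintype ι]
    (hι : Fintype.card ι = Module.finrank F E) {σ : ι → E →ₐ[F] K} (hσ : Function.Injective σ)
    (a : E) :
    (LinearMap.mulLeft F a).charpoly.map (algebraMap F K) = ∏ i, (X - C (σ i a)) := by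
  classical
  let b : Module.Basis ι F E := (Module.finBasis F E).reindex
    (Fintype.equivOfCardEq (by simp [hι]))
  let N : Matrix ι ι K := Matrix.of fun i j ↦ σ i (b j)
  let M := Algebra.leftMulMatrix b a
  -- A vanishing combination of the rows would be a linear relation among distinct embeddings,
  -- contradicting Dedekind independence.
  have hN : IsUnit N := by
    rw [Matrix.isUnit_iff_isUnit_det, isUnit_iff_ne_zero, Ne, ← Matrix.exists_vecMul_eq_zero_iff]
    rintro ⟨v, hv, h⟩
    have hli := (linearIndependent_toLinearMap F E K).comp σ hσ
    rw [Fintype.linearIndependent_iff] at hli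
    refine hv (funext fun i ↦ hli v (b.ext fun j ↦ ?_) i)
    simpa [Matrix.vecMul, dotProduct, N] using congrFun h j
  -- Multiplicativity of each `σ i` makes `N` diagonalise multiplication by `a`.
  have hcomm : N * M.map (algebraMap F K) = Matrix.diagonal (fun i ↦ σ i a) * N := by
    ext i j
    rw [Matrix.diagonal_mul, Matrix.mul_apply]
    simp only [N, M, Matrix.of_apply, Matrix.map_apply]
    rw [← map_mul, ← b.sum_repr (a * b j), map_sum]
    refine Finset.sum_congr rfl fun k _ ↦ ?_
    rw [Algebra.leftMulMatrix_eq_repr_mul, map_smul, Algebra.smul_def, mul_comm]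
  obtain ⟨U, hU⟩ := hN
  have hconj : (U : Matrix ι ι K) * M.map (algebraMap F K) * (U : Matrix ι ι K)⁻¹ =
      Matrix.diagonal (fun i ↦ σ i a) := by
    rw [← Matrix.coe_units_inv, hU, hcomm, ← hU, mul_assoc, Units.mul_inv, mul_one]
  rw [← LinearMap.charpoly_toMatrix _ b, Algebra.toMatrix_lmul_eq, ← Matrix.charpoly_map,
    ← Matrix.charpoly_diagonal, ← hconj, Matrix.charpoly_units_conj]

end Charpoly

/-! ### Finite algebras and their residue fields -/

section ReducedFiniteAlgebra

theorem ker_isMaximal_of_algHom {F R K : Type*} [Field F] [CommRing R] [Field K] [Algebra F R]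
    [Algebra F K] [Module.Finite F R] (f : R →ₐ[F] K) : (RingHom.ker f).IsMaximal := by
  have : IsArtinianRing R := .of_finite F R
  have : (RingHom.ker f).IsPrime := RingHom.ker_isPrime f
  exact IsArtinianRing.isMaximal_of_isPrime _

/-- Homomorphisms to a field are the homomorphisms out of the residue fields. -/
noncomputable def algHomEquivSigmaQuotient {F R K : Type*} [Field F] [CommRing R] [Field K]
    [Algebra F R] [Algebra F K] [Module.Finite F R] :
    (R →ₐ[F] K) ≃ Σ m : MaximalSpectrum R, (R ⧸ m.asIdeal →ₐ[F] K) where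
  toFun f := ⟨⟨RingHom.ker f, ker_isMaximal_of_algHom f⟩, Ideal.kerLiftAlg f⟩
  invFun x := x.2.comp (Ideal.Quotient.mkₐ F x.1.asIdeal)
  left_inv f := by ext; simp
  right_inv := by
    have aux (m : MaximalSpectrum R) (g : R ⧸ m.asIdeal →ₐ[F] K) :
        RingHom.ker (g.comp (Ideal.Quotient.mkₐ F m.asIdeal)) = m.asIdeal := by
      have := m.isMaximal
      let := Ideal.Quotient.field m.asIdeal
      ext x
      simp [RingHom.mem_ker, Ideal.Quotient.eq_zero_iff_mem]
    rintro ⟨⟨I, hI⟩, g⟩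
    have h := aux ⟨I, hI⟩ g
    dsimp only at h ⊢
    -- The kernel is generalised to a variable `J` so that the equality of ideals can be substituted
    -- in the dependent pair.
    have main : ∀ (J : Ideal R) (hJ : J.IsMaximal) (k : R ⧸ J →ₐ[F] K), J = I →
        k.comp (Ideal.Quotient.mkₐ F J) = g.comp (Ideal.Quotient.mkₐ F I) →
        (⟨⟨J, hJ⟩, k⟩ : Σ m : MaximalSpectrum R, (R ⧸ m.asIdeal →ₐ[F] K)) = ⟨⟨I, hI⟩, g⟩ := by
      rintro J hJ k rfl hk
      congr 1
      exact Ideal.Quotient.algHom_ext _ hk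
    exact main _ _ _ h (by ext; simp)

variable {F R K : Type*} [Field F] [CommRing R] [Field K] [Algebra F R] [Algebra F K]
  [Module.Finite F R]

theorem card_algHom_eq_card_maximalSpectrum_mul [FiniteDimensional F K] [IsGalois F K]
    (h : ∀ m : MaximalSpectrum R, Nonempty ((R ⧸ m.asIdeal) ≃ₐ[F] K)) :
    Nat.card (R →ₐ[F] K) = Nat.card (MaximalSpectrum R) * Module.finrank F K := by
  have : IsArtinianRing R := .of_finite F R
  rw [Nat.card_congr (algHomEquivSigmaQuotient.trans (Equiv.sigmaCongrRight fun m ↦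
    (((h m).some.arrowCongr (.refl)).trans (algEquivEquivAlgHom F K).symm.toEquiv))),
    Nat.card_congr (Equiv.sigmaEquivProd _ _), Nat.card_prod, IsGalois.card_aut_eq_finrank]

theorem nonempty_algEquiv_pi [IsReduced R]
    (h : ∀ m : MaximalSpectrum R, Nonempty ((R ⧸ m.asIdeal) ≃ₐ[F] K)) :
    Nonempty (R ≃ₐ[F] (Fin (Nat.card (MaximalSpectrum R)) → K)) := by
  have : IsArtinianRing R := .of_finite F R
  exact ⟨(((IsArtinianRing.equivPi R).restrictScalars F).trans
    (AlgEquiv.piCongrRight fun m ↦ (h m).some)).trans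
    (AlgEquiv.piCongrLeft F (fun _ ↦ K) (Finite.equivFin _))⟩

end ReducedFiniteAlgebra

/-! ### Normal closures and their Galois groups -/

section NormalClosure

variable (F E K : Type*) [Field F] [Field E] [Field K] [Algebra F E] [Algebra F K]
  [FiniteDimensional F E] [IsNormalClosure F E K]

theorem iSup_fieldRange_eq_top : ⨆ σ : E →ₐ[F] K, σ.fieldRange = ⊤ :=
  (Algebra.IsAlgebraic.isNormalClosure_iff.mp ‹IsNormalClosure F E K›).2

theorem finiteDimensional_of_isNormalClosure (F E K : Type*) [Field F] [Field E] [Field K]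
    [Algebra F E] [Algebra F K] [FiniteDimensional F E] [IsNormalClosure F E K] :
    FiniteDimensional F K := by
  have : ∀ σ : E →ₐ[F] K, FiniteDimensional F σ.fieldRange := fun σ ↦
    Module.Finite.equiv (AlgEquiv.ofInjectiveField σ).toLinearEquiv
  have h := IntermediateField.finiteDimensional_iSup_of_finite (K := F) (L := K)
    (t := fun σ : E →ₐ[F] K ↦ σ.fieldRange)
  rw [iSup_fieldRange_eq_top] at h
  exact Module.Finite.equiv IntermediateField.topEquiv.toLinearEquiv

theorem isGalois_of_isNormalClosure (F E K : Type*) [Field F] [Field E] [Field K]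
    [Algebra F E] [Algebra F K] [FiniteDimensional F E] [IsNormalClosure F E K]
    [Algebra.IsSeparable F E] : IsGalois F K := by
  have : Normal F K := IsNormalClosure.normal (K := E)
  have : ∀ σ : E →ₐ[F] K, Algebra.IsSeparable F σ.fieldRange := fun σ ↦
    (AlgEquiv.Algebra.isSeparable (AlgEquiv.ofInjectiveField σ))
  have h := IntermediateField.isSeparable_iSup F K (t := fun σ : E →ₐ[F] K ↦ σ.fieldRange)
  rw [iSup_fieldRange_eq_top] at h
  have : Algebra.IsSeparable F K := AlgEquiv.Algebra.isSeparable IntermediateField.topEquiv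
  exact ⟨⟩

theorem card_algHom_of_isNormalClosure [Algebra.IsSeparable F E] :
    Nat.card (E →ₐ[F] K) = Module.finrank F E := by
  rw [Nat.card_eq_fintype_card]
  exact AlgHom.card_of_splits F E K IsNormalClosure.splits

/-- The Galois group of a normal closure acts faithfully on the embeddings. -/
noncomputable def autToPermAlgHom : Gal(K/F) →* Equiv.Perm (E →ₐ[F] K) where
  toFun g :=
    { toFun := fun σ ↦ (g : K →ₐ[F] K).comp σ
      invFun := fun σ ↦ (g⁻¹ : Gal(K/F)).toAlgHom.comp σ
      left_inv := fun σ ↦ by ext; exact g.symm_apply_apply _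
      right_inv := fun σ ↦ by ext; exact g.apply_symm_apply _ }
  map_one' := rfl
  map_mul' _ _ := rfl

/-- An automorphism fixing every embedding fixes the compositum of their images, which is all of
`K`. -/
theorem autToPermAlgHom_injective : Function.Injective (autToPermAlgHom F E K) := by
  rw [injective_iff_map_eq_one]
  intro g hg
  have hle : ⨆ σ : E →ₐ[F] K, σ.fieldRange ≤
      IntermediateField.fixedField (Subgroup.zpowers g) := by
    refine iSup_le fun σ ↦ ?_
    rw [IntermediateField.le_iff_le, Subgroup.zpowers_le, IntermediateField.mem_fixingSubgroup_iff]
    rintro _ ⟨a, rfl⟩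
    exact DFunLike.congr_fun (DFunLike.congr_fun hg σ) a
  rw [iSup_fieldRange_eq_top, IntermediateField.le_iff_le, Subgroup.zpowers_le,
    IntermediateField.mem_fixingSubgroup_iff] at hle
  exact AlgEquiv.ext fun x ↦ hle x IntermediateField.mem_top

theorem finrank_eq_factorial_iff [Algebra.IsSeparable F E] :
    Module.finrank F K = (Module.finrank F E).factorial ↔
      Nonempty (Gal(K/F) ≃* Equiv.Perm (Fin (Module.finrank F E))) := by
  have := finiteDimensional_of_isNormalClosure F E K
  have := isGalois_of_isNormalClosure F E K
  have hcard : Nat.card (Equiv.Perm (Fin (Module.finrank F E))) =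
      (Module.finrank F E).factorial := by
    rw [Nat.card_perm, Nat.card_fin]
  rw [← IsGalois.card_aut_eq_finrank F K]
  constructor
  · intro h
    have e : (E →ₐ[F] K) ≃ Fin (Module.finrank F E) :=
      Finite.equivFinOfCardEq (card_algHom_of_isNormalClosure F E K)
    have hb : Function.Bijective (autToPermAlgHom F E K) := by
      rw [Nat.bijective_iff_injective_and_card]
      exact ⟨autToPermAlgHom_injective F E K, by
        rw [h, Nat.card_perm, card_algHom_of_isNormalClosure]⟩
    exact ⟨(MulEquiv.ofBijective _ hb).trans e.permCongrHom⟩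
  · rintro ⟨e⟩
    rw [Nat.card_congr e.toEquiv, hcard]

end NormalClosure

/-! ### Homomorphisms and residue fields of the closure -/

section SnClosure

open Polynomial

theorem conj_eq_singleAlgHom {B A : Type*} [CommRing B] [CommRing A] [Algebra B A]
    (i : Fin (Module.finrank B A)) (a : A) :
    conj B A i a = PiTensorProduct.singleAlgHom (R := B) (A := fun _ ↦ A) i a := rfl

variable {B A K : Type*} [Field B] [Field A] [Field K] [Algebra B A] [Algebra B K]
  [FiniteDimensional B A]

variable (B A) in
/-- The `i`-th conjugate homomorphism into the `S_n`-closure. -/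
noncomputable def conjAlgHom (i : Fin (Module.finrank B A)) : A →ₐ[B] SnClosure B A :=
  (Ideal.Quotient.mkₐ B (relIdeal B A)).comp (PiTensorProduct.singleAlgHom (R := B) (A := fun _ ↦ A) i)

theorem conjAlgHom_apply (i : Fin (Module.finrank B A)) (a : A) :
    conjAlgHom B A i a = Ideal.Quotient.mk (relIdeal B A) (conj B A i a) := rfl

theorem map_charpoly_eq_prod_iff {S : Type*} [CommRing S] [Algebra B S] (a : A)
    (x : Fin (Module.finrank B A) → S) :
    (LinearMap.mulLeft B a).charpoly.map (algebraMap B S) = ∏ i, (X - C (x i)) ↔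
      ∀ j, 1 ≤ j → j ≤ Module.finrank B A → algebraMap B S (charCoeff B A j a) =
        ∑ s ∈ (Finset.univ : Finset (Fin (Module.finrank B A))).powersetCard j, ∏ i ∈ s, x i := by
  cases subsingleton_or_nontrivial S
  · simp [eq_iff_true_of_subsingleton]
  rw [eq_prod_X_sub_C_iff ((LinearMap.charpoly_monic _).map _)
    (by rw [(LinearMap.charpoly_monic _).natDegree_map, LinearMap.charpoly_natDegree,
      Fintype.card_fin])]
  simp [charCoeff]

theorem map_charpoly_snClosure (a : A) :
    (LinearMap.mulLeft B a).charpoly.map (algebraMap B (SnClosure B A)) =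
      ∏ i, (X - C (conjAlgHom B A i a)) := by
  rw [map_charpoly_eq_prod_iff]
  intro j h1 hj
  have h : algebraMap B (TensorPow B A) (charCoeff B A j a) -
      ∑ s ∈ (Finset.univ : Finset (Fin (Module.finrank B A))).powersetCard j,
        ∏ i ∈ s, conj B A i a ∈ relIdeal B A := Ideal.subset_span ⟨a, j, h1, hj, rfl⟩
  rw [← Ideal.Quotient.eq_zero_iff_mem, map_sub, sub_eq_zero] at h
  simpa [conjAlgHom_apply] using h

theorem snClosure_algHom_ext {S : Type*} [CommRing S] [Algebra B S] {f g : SnClosure B A →ₐ[B] S}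
    (h : ∀ i, f.comp (conjAlgHom B A i) = g.comp (conjAlgHom B A i)) : f = g :=
  Ideal.Quotient.algHom_ext _ (PiTensorProduct.algHom_ext h)

theorem snClosure_mem_of_forall_conjAlgHom_mem (T : Subalgebra B (SnClosure B A))
    (h : ∀ i a, conjAlgHom B A i a ∈ T) (z : SnClosure B A) : z ∈ T := by
  obtain ⟨z, rfl⟩ := Ideal.Quotient.mk_surjective z
  exact mem_of_forall_singleAlgHom_mem (T.comap (Ideal.Quotient.mkₐ B (relIdeal B A))) h z

/-- The homomorphism from the `S_n`-closure attached to a tuple of homomorphisms that splits all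
characteristic polynomials. -/
noncomputable def snClosureLift {S : Type*} [CommRing S] [Algebra B S]
    (σ : Fin (Module.finrank B A) → A →ₐ[B] S)
    (h : ∀ a, (LinearMap.mulLeft B a).charpoly.map (algebraMap B S) =
      ∏ i, (X - C (σ i a))) : SnClosure B A →ₐ[B] S :=
  Ideal.Quotient.liftₐ _ (liftFamily σ) fun z hz ↦ by
    suffices relIdeal B A ≤ RingHom.ker (liftFamily σ) from this hz
    rw [relIdeal, Ideal.span_le]
    rintro _ ⟨a, j, h1, hj, rfl⟩
    have := (map_charpoly_eq_prod_iff a _).mp (h a) j h1 hj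
    rw [SetLike.mem_coe, RingHom.mem_ker, map_sub, AlgHom.commutes, this]
    simp [conj_eq_singleAlgHom, liftFamily_singleAlgHom, -PiTensorProduct.singleAlgHom_apply]

theorem snClosureLift_comp_conjAlgHom {S : Type*} [CommRing S] [Algebra B S]
    (σ : Fin (Module.finrank B A) → A →ₐ[B] S)
    (h : ∀ a, (LinearMap.mulLeft B a).charpoly.map (algebraMap B S) =
      ∏ i, (X - C (σ i a))) (i : Fin (Module.finrank B A)) :
    (snClosureLift σ h).comp (conjAlgHom B A i) = σ i :=
  AlgHom.ext fun a ↦ liftFamily_singleAlgHom σ i a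

/-- For a primitive element `a`, `τ a` is a root of the characteristic polynomial, hence equals the
image of some conjugate of `a`; this determines `τ`. -/
theorem surjective_comp_conjAlgHom [Algebra.IsSeparable B A] (f : SnClosure B A →ₐ[B] K) :
    Function.Surjective fun i ↦ f.comp (conjAlgHom B A i) := by
  intro τ
  let pb := Field.powerBasisOfFiniteOfSeparable B A
  have h := congrArg (Polynomial.map (f : SnClosure B A →+* K)) (map_charpoly_snClosure pb.gen)
  rw [Polynomial.map_map, AlgHom.comp_algebraMap, Polynomial.map_prod] at h
  have h0 : aeval (τ pb.gen) (LinearMap.mulLeft B pb.gen).charpoly = 0 := by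
    rw [aeval_algHom_apply]
    have := Algebra.aeval_self_charpoly_lmul (R := B) pb.gen
    exact (congrArg τ this).trans (map_zero τ)
  rw [← eval_map_algebraMap, h, eval_prod, Finset.prod_eq_zero_iff] at h0
  obtain ⟨i, -, hi⟩ := h0
  refine ⟨i, pb.algHom_ext ?_⟩
  rw [eq_comm, ← sub_eq_zero]
  simpa using hi

theorem isReduced_snClosure [Algebra.IsSeparable B A] : IsReduced (SnClosure B A) := by
  have := Algebra.FormallyUnramified.of_isSeparable B A
  have : Algebra.FormallyUnramified B (TensorPow B A) := formallyUnramified_piTensorProduct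
  exact Algebra.FormallyUnramified.isReduced_of_field B (SnClosure B A)

variable [Algebra.IsSeparable B A] [IsNormalClosure B A K]

theorem bijective_comp_conjAlgHom (f : SnClosure B A →ₐ[B] K) :
    Function.Bijective fun i ↦ f.comp (conjAlgHom B A i) := by
  rw [Nat.bijective_iff_surjective_and_card, Nat.card_fin, card_algHom_of_isNormalClosure]
  exact ⟨surjective_comp_conjAlgHom f, rfl⟩

variable (B A K) in
/-- Homomorphisms from the `S_n`-closure to a normal closure are the orderings of the
embeddings. -/
noncomputable def snClosureAlgHomEquiv :
    (SnClosure B A →ₐ[B] K) ≃ (Fin (Module.finrank B A) ≃ (A →ₐ[B] K)) where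
  toFun f := Equiv.ofBijective _ (bijective_comp_conjAlgHom f)
  invFun e := snClosureLift e fun a ↦
    charpoly_mulLeft_map_eq_prod (Fintype.card_fin _) e.injective a
  left_inv _ := snClosure_algHom_ext fun _ ↦ snClosureLift_comp_conjAlgHom _ _ _
  right_inv _ := Equiv.ext fun _ ↦ snClosureLift_comp_conjAlgHom _ _ _

variable (B A K) in
theorem card_snClosure_algHom :
    Nat.card (SnClosure B A →ₐ[B] K) = (Module.finrank B A).factorial := by
  classical
  let e : Fin (Module.finrank B A) ≃ (A →ₐ[B] K) :=
    (Finite.equivFinOfCardEq (card_algHom_of_isNormalClosure B A K)).symm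
  rw [Nat.card_congr ((snClosureAlgHomEquiv B A K).trans (Equiv.equivCongr (.refl _) e.symm)),
    Nat.card_perm, Nat.card_fin]

variable (K) in
/-- Every residue field of the `S_n`-closure is a normal closure. -/
theorem nonempty_algEquiv_of_surjective {L : Type*} [Field L] [Algebra B L]
    (f : SnClosure B A →ₐ[B] L) (hf : Function.Surjective f) : Nonempty (L ≃ₐ[B] K) := by
  -- `L` is generated by images of `A`, whose minimal polynomials split in `K`.
  obtain ⟨φ⟩ : Nonempty (L →ₐ[B] K) := by
    refine IntermediateField.nonempty_algHom_of_adjoin_splits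
      (S := ⋃ i, Set.range (f.comp (conjAlgHom B A i))) ?_ ?_
    · simp only [Set.mem_iUnion, Set.mem_range]
      rintro _ ⟨i, a, rfl⟩
      refine ⟨(Algebra.IsIntegral.isIntegral a).map _, ?_⟩
      rw [minpoly.algHom_eq _ (f.comp (conjAlgHom B A i)).injective]
      exact IsNormalClosure.splits a
    · rw [eq_top_iff]
      rintro x -
      obtain ⟨z, rfl⟩ := hf x
      refine snClosure_mem_of_forall_conjAlgHom_mem ((IntermediateField.adjoin B
        (⋃ i, Set.range (f.comp (conjAlgHom B A i)))).toSubalgebra.comap f) (fun i a ↦ ?_) z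
      exact IntermediateField.subset_adjoin _ _ (Set.mem_iUnion.mpr ⟨i, a, rfl⟩)
  refine ⟨AlgEquiv.ofBijective φ ⟨φ.injective, AlgHom.fieldRange_eq_top.mp ?_⟩⟩
  -- Every embedding of `A` in `K` factors through `φ.comp f`, so the range of `φ` contains the
  -- generators of `K`.
  rw [eq_top_iff, ← iSup_fieldRange_eq_top B A K]
  refine iSup_le fun τ ↦ ?_
  obtain ⟨i, rfl⟩ := surjective_comp_conjAlgHom (φ.comp f) τ
  rintro _ ⟨a, rfl⟩
  exact ⟨f (conjAlgHom B A i a), rfl⟩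

variable (K) in
theorem nonempty_residueField_algEquiv (m : MaximalSpectrum (SnClosure B A)) :
    Nonempty ((SnClosure B A ⧸ m.asIdeal) ≃ₐ[B] K) := by
  have := m.isMaximal
  let := Ideal.Quotient.field m.asIdeal
  exact nonempty_algEquiv_of_surjective K (Ideal.Quotient.mkₐ B m.asIdeal)
    Ideal.Quotient.mk_surjective

end SnClosure

end RankClosure

theorem theorem2 {B A A' : Type*} [Field B] [Field A] [Field A'] [Algebra B A] [Algebra B A']
    [FiniteDimensional B A] [Algebra.IsSeparable B A] [IsNormalClosure B A A']
    (n : ℕ) (hn : Module.finrank B A = n) :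
    (Module.finrank B A' ∣ n.factorial ∧
      Nonempty (RankClosure.SnClosure B A ≃ₐ[B]
        (Fin (n.factorial / Module.finrank B A') → A'))) ∧
    (Module.finrank B A' = n.factorial ↔
      Nonempty (Gal(A'/B) ≃* Equiv.Perm (Fin n))) ∧
    (Module.finrank B A' = n.factorial →
      Nonempty (RankClosure.SnClosure B A ≃ₐ[B] A')) := by
  subst hn
  have := RankClosure.finiteDimensional_of_isNormalClosure B A A'
  have := RankClosure.isGalois_of_isNormalClosure B A A'
  have := RankClosure.isReduced_snClosure (B := B) (A := A)
  have hres := RankClosure.nonempty_residueField_algEquiv (B := B) (A := A) A'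
  have hcard := RankClosure.card_algHom_eq_card_maximalSpectrum_mul hres
  rw [RankClosure.card_snClosure_algHom] at hcard
  have hr : (Module.finrank B A).factorial / Module.finrank B A' =
      Nat.card (MaximalSpectrum (RankClosure.SnClosure B A)) := by
    rw [hcard, Nat.mul_div_cancel _ Module.finrank_pos]
  have hpi := RankClosure.nonempty_algEquiv_pi hres
  rw [← hr] at hpi
  refine ⟨⟨Dvd.intro_left _ hcard.symm, hpi⟩, RankClosure.finrank_eq_factorial_iff B A A',
    fun h ↦ ?_⟩
  rw [h, Nat.div_self (Nat.factorial_pos _)] at hpi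
  exact hpi.map fun e ↦ e.trans (AlgEquiv.funUnique B (Fin 1) A')
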